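/- A weighted finite automaton (WFA) with $n$ states over a finite alphabet $\Sigma$ is a tuple $\mathcal A=\langle\alpha,\{A^\sigma\}_{\sigma\in\Sigma},\beta\rangle$ with $\alpha,\beta\in\mathbb R^n$ and $A^\sigma\in\mathbb R^{n\times n}$. For $x=x_1\cdots x_T\in\Sigma^T$ let $\mathcal A(x)\in\mathbb R^{(T+1)\times n}$ be the matrix whose rows are the states $\alpha^\top,\ \alpha^\top A^{x_1},\ \dots,\ \alpha^\top A^{x_1}\cdots A^{x_T}$. Transformers are maps on sequences of $m$ tokens $X\in\mathbb R^{m\times d}$ ($d$ is the embedding dimension), without residual connections. Each layer is a multi-head softmax attention block followed by an MLP block. A head computes $\mathrm{softmax}(XW_QW_K^\top X^\top)XW_V$, with row-wise softmax and $W_Q,W_K,W_V\in\mathbb R^{d\times k}$ ($k$ is the attention width); the outputs of the $h$ heads are concatenated and mapped linearly back to $\mathbb R^{m\times d}$. The MLP block applies to each row $v$ a two-layer perceptron $v\mapsto\varphi(vW_1+b_1)W_2+b_2$ with $N$ hidden units ($N$ is the MLP width) and activation $\varphi$ applied entrywise. The input word, preceded by one beginning-of-sequence token, is embedded by adding a token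 embedding and a positional embedding, and a linear readout $\mathbb R^d\to\mathbb R^n$ is applied at each of the $T+1$ positions to the output of the last layer. **Theorem.** Let $\varphi:\mathbb R\to\mathbb R$ be an activation function that is $C^2$ in a neighbourhood of some point $a$ with $\varphi''(a)\neq0$. For every $n$ there are a number of heads $h\le 2$, an embedding dimension $d\le 2n^2+2$, an attention width $k\le 2n^2+2$ and an MLP width $N\le 2n^4+3n^2+1$, and for every length $T$ there is a depth $L\le\lceil\log_2 T\rceil$ ($L=0$ if $T=0$), such that for every finite alphabet $\Sigma$, every $n$-state WFA $\mathcal A$ over $\Sigma$ and every $\varepsilon>0$ there is a transformer $f$ of depth $L$ with these sizes and activation $\varphi$ satisfying $$\|f(x)-\mathcal A(x)\|_F<\varepsilon\qquad\text{for all }x\in\Sigma^T .$$ In particular the depth is $\mathcal O(\log T)$, the embedding dimension and the attention width are $\mathcal O(n^2)$, the MLP width is $\mathcal O(n^4)$, the number of heads is $\mathcal O(1)$, and none of these sizes depends on $\varepsilon$, on $\Sigma$ or on the weights of $\mathcal A$. -/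

import Mathlib

open scoped Matrix

noncomputable section

/-- A weighted finite automaton with `n` states and real weights over the alphabet `S`. -/
structure WFA (S : Type*) (n : ℕ) where
  /-- initial weight vector -/
  init : Fin n → ℝ
  /-- final weight vector -/
  final : Fin n → ℝ
  /-- transition matrix of each symbol -/
  trans : S → Matrix (Fin n) (Fin n) ℝ

namespace WFA

variable {S : Type*} {n : ℕ}

/-- The real-valued function on words realized by the automaton. -/
def realize (A : WFA S n) (w : List S) : ℝ :=
  (A.init ᵥ* (w.map A.trans).prod) ⬝ᵥ A.final

/-- The state (a row vector) reached after reading the word `w`. -/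
def state (A : WFA S n) (w : List S) : Fin n → ℝ :=
  A.init ᵥ* (w.map A.trans).prod

/-- The sequence of states on a word `x` of length `T`: row `t` is the state after the first `t`
symbols, for `t = 0, …, T`. -/
def states (A : WFA S n) {T : ℕ} (x : Fin T → S) : Matrix (Fin (T + 1)) (Fin n) ℝ :=
  Matrix.of fun t => A.state ((List.ofFn x).take t)

end WFA

section Simulation

attribute [local instance] Matrix.frobeniusNormedAddCommGroup

/-- `f` approximately simulates `A` at length `T` with precision `ε`, in Frobenius norm. -/
def ApproxSimulates {S : Type*} {n : ℕ} (A : WFA S n) (T : ℕ) (ε : ℝ)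
    (f : (Fin T → S) → Matrix (Fin (T + 1)) (Fin n) ℝ) : Prop :=
  ∀ x : Fin T → S, ‖f x - A.states x‖ < ε

end Simulation

/-- Row-wise softmax. -/
def rowSoftmax {m p : Type*} [Fintype p] (M : Matrix m p ℝ) : Matrix m p ℝ :=
  Matrix.of fun i j => Real.exp (M i j) / ∑ l, Real.exp (M i l)

/-- One head of self-attention. -/
def selfAttention {m d k : ℕ} (WQ WK WV : Matrix (Fin d) (Fin k) ℝ)
    (X : Matrix (Fin m) (Fin d) ℝ) : Matrix (Fin m) (Fin k) ℝ :=
  rowSoftmax (X * WQ * WKᵀ * Xᵀ) * X * WV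

/-- Parameters of a multi-head attention block with `h` heads, embedding dimension `d` and
attention width `k`. -/
structure AttentionBlock (h d k : ℕ) where
  WQ : Fin h → Matrix (Fin d) (Fin k) ℝ
  WK : Fin h → Matrix (Fin d) (Fin k) ℝ
  WV : Fin h → Matrix (Fin d) (Fin k) ℝ
  /-- the linear layer applied to the concatenation of the heads -/
  WO : Matrix (Fin h × Fin k) (Fin d) ℝ

/-- Concatenate the outputs of the heads and apply the linear layer. -/
def AttentionBlock.apply {h d k m : ℕ} (a : AttentionBlock h d k)
    (X : Matrix (Fin m) (Fin d) ℝ) : Matrix (Fin m) (Fin d) ℝ :=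
  (Matrix.of fun t (p : Fin h × Fin k) =>
    selfAttention (a.WQ p.1) (a.WK p.1) (a.WV p.1) X t p.2) * a.WO

/-- Parameters of a two-layer perceptron on `ℝ^d` with one hidden layer of width `N`. -/
structure MLPBlock (d N : ℕ) where
  W₁ : Matrix (Fin d) (Fin N) ℝ
  b₁ : Fin N → ℝ
  W₂ : Matrix (Fin N) (Fin d) ℝ
  b₂ : Fin d → ℝ

/-- Apply the perceptron with activation function `act` to every row. -/
def MLPBlock.apply {d N m : ℕ} (act : ℝ → ℝ) (p : MLPBlock d N)
    (X : Matrix (Fin m) (Fin d) ℝ) : Matrix (Fin m) (Fin d) ℝ :=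
  Matrix.of fun t => (fun i => act ((X t ᵥ* p.W₁) i + p.b₁ i)) ᵥ* p.W₂ + p.b₂

/-- A transformer layer: multi-head attention followed by a two-layer perceptron. -/
structure TransformerLayer (h d k N : ℕ) where
  attn : AttentionBlock h d k
  mlp : MLPBlock d N

/-- The map computed by a layer on sequences of `m` tokens. -/
def TransformerLayer.apply {h d k N m : ℕ} (act : ℝ → ℝ) (l : TransformerLayer h d k N)
    (X : Matrix (Fin m) (Fin d) ℝ) : Matrix (Fin m) (Fin d) ℝ :=
  l.mlp.apply act (l.attn.apply X)

/-- A transformer reading words of length `T` over `S`, preceded by one beginning-of-sequence token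
(written `none`), and writing one vector of `ℝ^n` at each of the `T + 1` positions. -/
structure Transformer (S : Type*) (T n h d k N : ℕ) where
  /-- token embedding -/
  tok : Option S → Fin d → ℝ
  /-- positional embedding -/
  pos : Fin (T + 1) → Fin d → ℝ
  /-- the layers, the first one being applied first -/
  layers : List (TransformerLayer h d k N)
  /-- linear readout, applied to every position -/
  readout : Matrix (Fin d) (Fin n) ℝ

namespace Transformer

variable {S : Type*} {T n h d k N : ℕ}

/-- The number of layers. -/
def depth (f : Transformer S T n h d k N) : ℕ := f.layers.length

/-- The embedded input sequence. -/
def embed (f : Transformer S T n h d k N) (x : Fin T → S) : Matrix (Fin (T + 1)) (Fin d) ℝ :=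
  Matrix.of fun t => f.tok ((Fin.cons none fun i => some (x i) : Fin (T + 1) → Option S) t)
    + f.pos t

/-- The function computed by the transformer with activation function `act`. -/
def eval (act : ℝ → ℝ) (f : Transformer S T n h d k N) (x : Fin T → S) :
    Matrix (Fin (T + 1)) (Fin n) ℝ :=
  (f.layers.foldl (fun X l => l.apply act X) (f.embed x)) * f.readout

end Transformer

end

/-!
The state after `t` symbols is `α ᵥ* (A^{x₁} ⋯ A^{x_t})`, and the prefix products are computed by
recursive doubling. Row `t` of the sequence stores the product of the last `s` transition matrices
read before position `t` (`WFA.window`), together with the point of the unit circle of angle `θ t`.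
Since the first row stores the empty product `1`, one has
`window (2 * s) t = window s (t - s) * window s t` with truncated subtraction
(`WFA.window_shift_mul_window`), so one layer only has to fetch the rows `t` and `t - s` and to
multiply two `n × n` matrices. It passes from `s` to `2 * s`, hence `⌈log₂ T⌉` layers suffice, and
the readout applies the linear map `P ↦ α ᵥ* P`.

*Attention.* Two heads fetch the two rows. Rotating the query by the angle `θ s` gives the score
`cos (θ (t - s - j))`. As `θ = π / (2 T + 1)`, all the angles that occur lie in `[-π, π]`, so the
score has its strict maximum at the row `j` nearest to `t - s`, which is the truncated difference
(`cos_lt_cos_of_ne_shift`). Multiplying the scores by `c → ∞` turns softmax into the selection of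
that row (`tendsto_selfAttention`).

*Perceptron.* If `φ (a + u) = φ a + c₁ u + c₂ u² + o(u²)` with `c₁, c₂ ≠ 0`, then with `h = 1 / c`
the sum `∑ σ τ φ (a + h (σ u + τ v))` over the signs `σ, τ` is `8 c₂ h² u v + o(h²)`: four hidden
units give a product, hence `4 n ^ 3` units the matrix product. One more unit for each of the two
positional coordinates returns it, as `φ (a + h u) - φ a = c₁ h u + o(h)` (`tendsto_probeMLP`).
The point `a` can be moved slightly to ensure `c₁ ≠ 0`, because `φ''` does not vanish nearby.

No quantitative estimate is needed. Each layer converges continuously in `c`: if the inputs `X c`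
tend to `Y`, then the outputs of the layers at `X c` tend to the ideal output at `Y`
(`tendsto_doublingLayer`). Such limits compose, and there are only finitely many words of length
`T`, so one large `c` works for all of them.
-/

open Filter Topology Asymptotics

/-! ### Second-order expansion of the activation function -/

/-- An activation function with `f'' ≠ 0` somewhere has an expansion of order two, with nonzero
linear and quadratic coefficients, at some point. -/
theorem exists_taylor_two {f : ℝ → ℝ}
    (hf : ∃ a : ℝ, ContDiffAt ℝ 2 f a ∧ iteratedDeriv 2 f a ≠ 0) :
    ∃ a c₁ c₂ : ℝ, c₁ ≠ 0 ∧ c₂ ≠ 0 ∧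
      (fun u => f (a + u) - (f a + c₁ * u + c₂ * u ^ 2)) =o[𝓝 0] fun u => u ^ 2 := by
  obtain ⟨a₀, h₀, hne₀⟩ := hf
  have hev : ∀ᶠ x in 𝓝 a₀, ContDiffAt ℝ 2 f x := h₀.eventually (by simp)
  have hcont : ContinuousAt (iteratedDeriv 2 f) a₀ := by
    have h1 : ContDiffAt ℝ 0 (iteratedFDeriv ℝ 2 f) a₀ :=
      h₀.iteratedFDeriv_right (i := 2) (by simp)
    exact (ContinuousMultilinearMap.apply ℝ (fun _ : Fin 2 => ℝ) ℝ
      (fun _ => 1)).continuous.continuousAt.comp h1.continuousAt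
  have hne : ∀ᶠ x in 𝓝 a₀, iteratedDeriv 2 f x ≠ 0 := hcont.eventually_ne hne₀
  obtain ⟨a, ha, ha2, ha1⟩ : ∃ a, ContDiffAt ℝ 2 f a ∧ iteratedDeriv 2 f a ≠ 0 ∧
      deriv f a ≠ 0 := by
    by_cases hd : deriv f a₀ = 0
    -- `f'` vanishes at `a₀` with nonzero derivative, so it does not vanish at nearby points.
    · have hdd : HasDerivAt (deriv f) (iteratedDeriv 2 f a₀) a₀ := by
        rw [iteratedDeriv_succ, iteratedDeriv_one]
        refine DifferentiableAt.hasDerivAt (differentiableAt_of_deriv_ne_zero ?_)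
        rwa [iteratedDeriv_succ, iteratedDeriv_one] at hne₀
      have h3 := hdd.eventually_ne (c := 0) hne₀
      obtain ⟨x, hx⟩ := (h3.and ((hev.and hne).filter_mono nhdsWithin_le_nhds)).exists
      exact ⟨x, hx.2.1, hx.2.2, hx.1⟩
    · exact ⟨a₀, h₀, hne₀, hd⟩
  obtain ⟨r, hr, hball⟩ := Metric.eventually_nhds_iff_ball.1
    (ha.eventually (by simp) : ∀ᶠ x in 𝓝 a, ContDiffAt ℝ 2 f x)
  have hmem : a ∈ Metric.ball a r := Metric.mem_ball_self hr
  have hT := taylor_isLittleO (f := f) (n := 2) (convex_ball a r) hmem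
    (fun x hx => (hball x hx).contDiffWithinAt)
  rw [Metric.isOpen_ball.nhdsWithin_eq hmem] at hT
  have hu : UniqueDiffOn ℝ (Metric.ball a r) := Metric.isOpen_ball.uniqueDiffOn
  refine ⟨a, deriv f a, iteratedDeriv 2 f a / 2, ha1, by simpa using ha2, ?_⟩
  have hcomp : Tendsto (fun u : ℝ => a + u) (𝓝 0) (𝓝 a) := by
    simpa using (continuous_const_add a).tendsto 0
  refine (hT.comp_tendsto hcomp).congr (fun u => ?_) (fun u => by simp)
  simp only [Function.comp, taylorWithinEval_succ, taylor_within_zero_eval]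
  rw [iteratedDerivWithin_eq_iteratedDeriv hu (ha.of_le (by simp)) hmem,
    iteratedDerivWithin_eq_iteratedDeriv hu ha hmem, zero_add, iteratedDeriv_one]
  simp
  ring

/-- The error of the expansion at `a + h u` is `o(h²)` when `h → 0` and `u` converges. -/
theorem tendsto_taylor_remainder {f : ℝ → ℝ} {a c₁ c₂ : ℝ}
    (hf : (fun u => f (a + u) - (f a + c₁ * u + c₂ * u ^ 2)) =o[𝓝 0] fun u => u ^ 2)
    {l : Filter ℝ} {h u : ℝ → ℝ} {x : ℝ}
    (hh : Tendsto h l (𝓝 0)) (hu : Tendsto u l (𝓝 x)) :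
    Tendsto (fun c => (f (a + h c * u c) - (f a + c₁ * (h c * u c) + c₂ * (h c * u c) ^ 2))
      / h c ^ 2) l (𝓝 0) := by
  have h0 : Tendsto (fun c => h c * u c) l (𝓝 0) := by simpa using hh.mul hu
  have h1 : (fun c => (h c * u c) ^ 2) =O[l] fun c => h c ^ 2 := by
    simpa [mul_pow] using
      (isBigO_refl (fun c => h c ^ 2) l).mul ((hu.pow 2).isBigO_one ℝ)
  exact ((hf.comp_tendsto h0).trans_isBigO h1).tendsto_div_nhds_zero

/-- One hidden unit recovers its input in the limit `h → 0`. -/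
theorem tendsto_linear_probe {f : ℝ → ℝ} {a c₁ c₂ : ℝ}
    (hf : (fun u => f (a + u) - (f a + c₁ * u + c₂ * u ^ 2)) =o[𝓝 0] fun u => u ^ 2)
    {l : Filter ℝ} {h u : ℝ → ℝ} {x : ℝ} (hc₁ : c₁ ≠ 0)
    (hh : Tendsto h l (𝓝 0)) (hne : ∀ᶠ c in l, h c ≠ 0) (hu : Tendsto u l (𝓝 x)) :
    Tendsto (fun c => f (a + h c * u c) * (h c * c₁)⁻¹ - f a * (h c * c₁)⁻¹) l (𝓝 x) := by
  have h1 := ((((tendsto_taylor_remainder hf hh hu).add ((hu.pow 2).const_mul c₂)).mul hh).mul_const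
    c₁⁻¹).add hu
  rw [mul_zero, zero_mul, zero_add] at h1
  refine h1.congr' ?_
  filter_upwards [hne] with c hc
  field_simp
  ring

/-- Four hidden units recover the product of two inputs in the limit `h → 0`: the constant and linear
terms of the expansion cancel in the signed sum, and the squares leave `8 c₂ h² u v`. -/
theorem tendsto_product_probe {f : ℝ → ℝ} {a c₁ c₂ : ℝ}
    (hf : (fun u => f (a + u) - (f a + c₁ * u + c₂ * u ^ 2)) =o[𝓝 0] fun u => u ^ 2)
    {l : Filter ℝ} {h u v : ℝ → ℝ} {x y : ℝ} (hc₂ : c₂ ≠ 0)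
    (hh : Tendsto h l (𝓝 0)) (hne : ∀ᶠ c in l, h c ≠ 0)
    (hu : Tendsto u l (𝓝 x)) (hv : Tendsto v l (𝓝 y)) :
    Tendsto (fun c => (f (a + h c * (u c + v c)) - f (a + h c * (u c - v c))
      - f (a + h c * (-u c + v c)) + f (a + h c * (-u c - v c))) * (8 * h c ^ 2 * c₂)⁻¹)
      l (𝓝 (x * y)) := by
  have r := fun {w : ℝ → ℝ} {z : ℝ} (hw : Tendsto w l (𝓝 z)) => tendsto_taylor_remainder hf hh hw
  have h1 := ((((r (hu.add hv)).sub (r (hu.sub hv))).sub (r (hu.neg.add hv))).add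
    (r (hu.neg.sub hv))).mul_const (8 * c₂)⁻¹ |>.add (hu.mul hv)
  rw [sub_zero, sub_zero, add_zero, zero_mul, zero_add] at h1
  refine h1.congr' ?_
  filter_upwards [hne] with c hc
  field_simp
  ring

/-! ### Softmax with large scores -/

/-- Softmax selects the entry `r` when the scores of all the others fall infinitely far below that
of `r`. -/
theorem tendsto_exp_div_sum_exp {p : Type*} [Fintype p] [DecidableEq p] {l : Filter ℝ}
    {s : ℝ → p → ℝ} {r : p}
    (hs : ∀ j, j ≠ r → Tendsto (fun c => s c j - s c r) l atBot) (j : p) :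
    Tendsto (fun c => Real.exp (s c j) / ∑ k, Real.exp (s c k)) l
      (𝓝 (if j = r then 1 else 0)) := by
  have hexp : ∀ k, Tendsto (fun c => Real.exp (s c k - s c r)) l
      (𝓝 (if k = r then 1 else 0)) := by
    intro k
    split_ifs with hk
    · subst hk; simpa using tendsto_const_nhds
    · exact Real.tendsto_exp_atBot.comp (hs k hk)
  have h1 := (hexp j).div (tendsto_finsetSum Finset.univ fun k _ => hexp k) (by simp)
  rw [Finset.sum_ite_eq' Finset.univ r, if_pos (Finset.mem_univ r), div_one] at h1
  refine h1.congr fun c => ?_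
  simp only [Real.exp_sub, Pi.div_apply, ← Finset.sum_div]
  rw [div_div_div_cancel_right₀ (Real.exp_ne_zero _)]

theorem tendsto_matrix_mul {α m n p : Type*} [Fintype n] {l : Filter α}
    {A : α → Matrix m n ℝ} {B : α → Matrix n p ℝ} {A₀ : Matrix m n ℝ} {B₀ : Matrix n p ℝ}
    (hA : Tendsto A l (𝓝 A₀)) (hB : Tendsto B l (𝓝 B₀)) :
    Tendsto (fun c => A c * B c) l (𝓝 (A₀ * B₀)) :=
  ((continuous_fst.matrix_mul continuous_snd).tendsto (A₀, B₀)).comp (hA.prodMk_nhds hB)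

/-- The attention block whose head `i` has the scores `c • (X * B i * Xᵀ)`. Its attention width is the
embedding dimension: the key and value matrices are the identity, so a head returns whole rows, and
the output matrix `O` does the selection of coordinates. -/
def sharpAttention {h d : ℕ} (B : Fin h → Matrix (Fin d) (Fin d) ℝ)
    (O : Matrix (Fin h × Fin d) (Fin d) ℝ) (c : ℝ) : AttentionBlock h d d where
  WQ i := c • B i
  WK _ := 1
  WV _ := 1
  WO := O

/-- If row `t` of the limiting scores has its strict maximum at `r t`, a head with scores multiplied
by `c → ∞` copies row `r t` to row `t`. -/
theorem tendsto_selfAttention {m d : ℕ} {B : Matrix (Fin d) (Fin d) ℝ}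
    {X : ℝ → Matrix (Fin m) (Fin d) ℝ} {Y : Matrix (Fin m) (Fin d) ℝ}
    (hX : Tendsto X atTop (𝓝 Y)) {r : Fin m → Fin m}
    (hr : ∀ t j, j ≠ r t → (Y * B * Yᵀ) t j < (Y * B * Yᵀ) t (r t)) :
    Tendsto (fun c => selfAttention (c • B) 1 1 (X c)) atTop (𝓝 (Y.submatrix r id)) := by
  have hscore : Tendsto (fun c => X c * B * (X c)ᵀ) atTop (𝓝 (Y * B * Yᵀ)) :=
    ((continuous_id.matrix_mul continuous_const).matrix_mul
      continuous_id.matrix_transpose).continuousAt.tendsto.comp hX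
  have hentry : ∀ t j, Tendsto (fun c => (X c * B * (X c)ᵀ) t j) atTop (𝓝 ((Y * B * Yᵀ) t j)) :=
    fun t j => tendsto_pi_nhds.1 (tendsto_pi_nhds.1 hscore t) j
  have hsoft : Tendsto (fun c => rowSoftmax (X c * (c • B) * (1 : Matrix (Fin d) (Fin d) ℝ)ᵀ
      * (X c)ᵀ)) atTop (𝓝 (Matrix.of fun t j => if j = r t then (1 : ℝ) else 0)) := by
    refine tendsto_pi_nhds.2 fun t => tendsto_pi_nhds.2 fun j => ?_
    refine tendsto_exp_div_sum_exp (fun k hk => ?_) j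
    have := tendsto_id.atTop_mul_neg (sub_neg.2 (hr t k hk)) ((hentry t k).sub (hentry t (r t)))
    refine this.congr fun c => ?_
    simp [mul_sub]
  have := (tendsto_matrix_mul hsoft hX)
  simp only [selfAttention, Matrix.mul_one]
  convert this using 2
  ext t p
  simp [Matrix.mul_apply]

theorem tendsto_sharpAttention {h m d : ℕ} {B : Fin h → Matrix (Fin d) (Fin d) ℝ}
    {O : Matrix (Fin h × Fin d) (Fin d) ℝ}
    {X : ℝ → Matrix (Fin m) (Fin d) ℝ} {Y : Matrix (Fin m) (Fin d) ℝ}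
    (hX : Tendsto X atTop (𝓝 Y)) {r : Fin h → Fin m → Fin m}
    (hr : ∀ i t j, j ≠ r i t → (Y * B i * Yᵀ) t j < (Y * B i * Yᵀ) t (r i t)) :
    Tendsto (fun c => (sharpAttention B O c).apply (X c)) atTop
      (𝓝 ((Matrix.of fun t (p : Fin h × Fin d) => Y (r p.1 t) p.2) * O)) := by
  refine tendsto_matrix_mul ?_ tendsto_const_nhds
  refine tendsto_pi_nhds.2 fun t => tendsto_pi_nhds.2 fun p => ?_
  exact tendsto_pi_nhds.1 (tendsto_pi_nhds.1 (tendsto_selfAttention hX (hr p.1)) t) p.2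

/-! ### Coordinates of a row -/

/-- Coordinates of the embedding space: two `n × n` matrices, the second one being working space,
and the two coordinates of a point of the circle. -/
abbrev Coord (n : ℕ) : Type := ((Fin n × Fin n) ⊕ (Fin n × Fin n)) ⊕ Fin 2

/-- Hidden units of the perceptron: for each summand `Q i k * P k j` of a matrix product, indexed by
`(i, j, k)`, one unit for each pair of signs, and one unit for each positional coordinate. -/
abbrev Hidden (n : ℕ) : Type := ((Fin n × Fin n × Fin n) × Fin 2 × Fin 2) ⊕ Fin 2

/-- A numbering of the coordinates. -/
noncomputable def coordEquiv (n : ℕ) : Coord n ≃ Fin (2 * n ^ 2 + 2) :=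
  Fintype.equivFinOfCardEq (by simp; ring)

/-- A numbering of the hidden units. -/
noncomputable def hiddenEquiv (n : ℕ) : Hidden n ≃ Fin (4 * n ^ 3 + 2) :=
  Fintype.equivFinOfCardEq (by simp; ring)

/-- The row storing the matrices `P` and `Q` and the point of angle `φ` of the unit circle. -/
noncomputable def tokenRow {n : ℕ} (P Q : Matrix (Fin n) (Fin n) ℝ) (φ : ℝ) :
    Fin (2 * n ^ 2 + 2) → ℝ :=
  fun p => Sum.elim (Sum.elim (fun ij => P ij.1 ij.2) (fun ij => Q ij.1 ij.2))
    ![Real.cos φ, Real.sin φ] ((coordEquiv n).symm p)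

/-- The sequence whose row `t` stores `P t`, `Q t` and the point of angle `θ * t`. -/
noncomputable def tokens {n m : ℕ} (P Q : Fin m → Matrix (Fin n) (Fin n) ℝ) (θ : ℝ) :
    Matrix (Fin m) (Fin (2 * n ^ 2 + 2)) ℝ :=
  Matrix.of fun t => tokenRow (P t) (Q t) (θ * t)

/-! ### Attending to an earlier position -/

/-- The position `s` steps before `t`, or the first position if there is none: the subtraction is
truncated. -/
def shift {T : ℕ} (s : ℕ) (t : Fin (T + 1)) : Fin (T + 1) :=
  ⟨t - s, by omega⟩

/-- The bilinear form on rows that pairs the first point of the circle, rotated by `-φ`, with the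
second one. -/
noncomputable def rotationScore (n : ℕ) (φ : ℝ) :
    Matrix (Fin (2 * n ^ 2 + 2)) (Fin (2 * n ^ 2 + 2)) ℝ :=
  (Matrix.fromBlocks 0 0 0 !![Real.cos φ, -Real.sin φ; Real.sin φ, Real.cos φ]).submatrix
    (coordEquiv n).symm (coordEquiv n).symm

theorem tokens_rotationScore {n m : ℕ} (P Q : Fin m → Matrix (Fin n) (Fin n) ℝ) (θ φ : ℝ)
    (t j : Fin m) :
    (tokens P Q θ * rotationScore n φ * (tokens P Q θ)ᵀ) t j = Real.cos (θ * t - φ - θ * j) := by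
  have htok : tokens P Q θ = (Matrix.of fun t : Fin m =>
      Sum.elim (Sum.elim (fun ij : Fin n × Fin n => P t ij.1 ij.2) (fun ij => Q t ij.1 ij.2))
        ![Real.cos (θ * t), Real.sin (θ * t)]).submatrix id (coordEquiv n).symm := rfl
  rw [htok, rotationScore, Matrix.submatrix_mul_equiv, Matrix.transpose_submatrix,
    Matrix.submatrix_mul_equiv]
  simp only [Matrix.mul_apply, Matrix.submatrix_apply, Matrix.transpose_apply, Matrix.of_apply,
    Fintype.sum_sum_type, Fin.sum_univ_two, Real.cos_sub, Real.sin_sub]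
  simp [-mul_eq_mul_right_iff, -mul_eq_mul_left_iff]
  ring

/-- The score of position `j`, seen from `t` through the rotation by `s` steps, has its strict maximum
at `shift s t`. If `t < s`, no angle vanishes, but the first position still has the smallest one. -/
theorem cos_lt_cos_of_ne_shift {T s : ℕ} (hs : s ≤ T) {t j : Fin (T + 1)} (hj : j ≠ shift s t) :
    let θ := Real.pi / (2 * T + 1)
    Real.cos (θ * t - θ * s - θ * j) < Real.cos (θ * t - θ * s - θ * (shift s t)) := by
  intro θ
  have hθ : 0 < θ := by positivity
  rw [← Real.cos_abs, ← Real.cos_abs (θ * t - θ * s - θ * (shift s t)), ← mul_sub, ← mul_sub,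
    ← mul_sub, abs_mul, abs_mul, abs_of_pos hθ]
  have hlt : |((t : ℕ) : ℝ) - s - (shift s t : ℕ)| < |((t : ℕ) : ℝ) - s - (j : ℕ)| := by
    have hj' : (j : ℕ) ≠ t - s := fun h => hj (Fin.ext h)
    have : |((t : ℕ) : ℤ) - s - (shift s t : ℕ)| < |((t : ℕ) : ℤ) - s - (j : ℕ)| := by
      simp only [shift, abs_eq_max_neg]; omega
    exact_mod_cast this
  have hle : |((t : ℕ) : ℝ) - s - (j : ℕ)| ≤ 2 * T := by
    have : |((t : ℕ) : ℤ) - s - (j : ℕ)| ≤ 2 * T := by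
      simp only [abs_eq_max_neg]; omega
    exact_mod_cast this
  refine Real.cos_lt_cos_of_nonneg_of_le_pi (by positivity) ?_ (by gcongr)
  calc θ * _ ≤ θ * (2 * T + 1) := by gcongr; linarith
    _ = Real.pi := div_mul_cancel₀ _ (by positivity)

/-- The head and the coordinate that each coordinate is read from: the second matrix is the first
matrix of the row fetched by head `1`, everything else comes from head `0`. -/
def gatherSource {n : ℕ} : Coord n → Fin 2 × Coord n
  | .inl (.inl ij) => (0, .inl (.inl ij))
  | .inl (.inr ij) => (1, .inl (.inl ij))
  | .inr b => (0, .inr b)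

/-- The output matrix of the attention block that reads each coordinate from its `gatherSource`. -/
noncomputable def gather (n : ℕ) : Matrix (Fin 2 × Fin (2 * n ^ 2 + 2)) (Fin (2 * n ^ 2 + 2)) ℝ :=
  Matrix.of fun x q =>
    if x = Prod.map id (coordEquiv n) (gatherSource ((coordEquiv n).symm q)) then 1 else 0

theorem heads_mul_gather {n T : ℕ} (P Q : Fin (T + 1) → Matrix (Fin n) (Fin n) ℝ) (θ : ℝ)
    (r : Fin (T + 1) → Fin (T + 1)) (r' : Fin 2 → Fin (T + 1) → Fin (T + 1))
    (h0 : r' 0 = id) (h1 : r' 1 = r) :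
    (Matrix.of fun t (p : Fin 2 × Fin (2 * n ^ 2 + 2)) => tokens P Q θ (r' p.1 t) p.2) * gather n
      = tokens P (P ∘ r) θ := by
  ext t q
  obtain ⟨q, rfl⟩ := (coordEquiv n).surjective q
  simp only [Matrix.mul_apply, gather, Matrix.of_apply, mul_ite, mul_one, mul_zero,
    Finset.sum_ite_eq', Finset.mem_univ, if_true]
  rcases q with (ij | ij) | b <;> simp [gatherSource, tokens, tokenRow, h0, h1]

/-! ### Multiplying matrices with the perceptron -/

/-- The perceptron that approximately replaces the stored matrices `P, Q` by `Q * P, 0` and keeps the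
position. Hidden units are evaluated at distance `O(h)` from `a`; the signs are `(-1) ^ σ` and
`(-1) ^ τ`, and `fa` is the value of the activation function at `a`. -/
noncomputable def probeMLP (n : ℕ) (fa a c₁ c₂ h : ℝ) : MLPBlock (2 * n ^ 2 + 2) (4 * n ^ 3 + 2) where
  W₁ := (Matrix.of fun (p : Coord n) (q : Hidden n) => match q with
    | .inl ((i, j, k), σ, τ) => h * (((-1) ^ (σ : ℕ) * if p = .inl (.inr (i, k)) then 1 else 0)
        + (-1) ^ (τ : ℕ) * if p = .inl (.inl (k, j)) then 1 else 0)
    | .inr b => h * if p = .inr b then 1 else 0).submatrix (coordEquiv n).symm (hiddenEquiv n).symm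
  b₁ _ := a
  W₂ := (Matrix.of fun (q : Hidden n) (p : Coord n) => match q with
    | .inl ((i, j, _), σ, τ) =>
        if p = .inl (.inl (i, j)) then (-1) ^ (σ : ℕ) * (-1) ^ (τ : ℕ) * (8 * h ^ 2 * c₂)⁻¹ else 0
    | .inr b => if p = .inr b then (h * c₁)⁻¹ else 0).submatrix
      (hiddenEquiv n).symm (coordEquiv n).symm
  b₂ p := Sum.elim (fun _ => 0) (fun _ => -(fa * (h * c₁)⁻¹)) ((coordEquiv n).symm p)

theorem probeMLP_apply {n m : ℕ} (f : ℝ → ℝ) (fa a c₁ c₂ h : ℝ)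
    (X : Matrix (Fin m) (Fin (2 * n ^ 2 + 2)) ℝ) (t : Fin m) (p : Coord n) :
    let y : Coord n → ℝ := fun q => X t (coordEquiv n q)
    (probeMLP n fa a c₁ c₂ h).apply f X t (coordEquiv n p) =
      match p with
      | .inl (.inl (i, j)) => ∑ k,
          (f (a + h * (y (.inl (.inr (i, k))) + y (.inl (.inl (k, j)))))
          - f (a + h * (y (.inl (.inr (i, k))) - y (.inl (.inl (k, j)))))
          - f (a + h * (-y (.inl (.inr (i, k))) + y (.inl (.inl (k, j)))))
          + f (a + h * (-y (.inl (.inr (i, k))) - y (.inl (.inl (k, j))))))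
            * (8 * h ^ 2 * c₂)⁻¹
      | .inl (.inr _) => 0
      | .inr b => f (a + h * y (.inr b)) * (h * c₁)⁻¹ - fa * (h * c₁)⁻¹ := by
  intro y
  have hin : ∀ q : Hidden n, (X t ᵥ* (probeMLP n fa a c₁ c₂ h).W₁) (hiddenEquiv n q) =
      match q with
      | .inl ((i, j, k), σ, τ) => h * ((-1) ^ (σ : ℕ) * y (.inl (.inr (i, k)))
        + (-1) ^ (τ : ℕ) * y (.inl (.inl (k, j))))
      | .inr b => h * y (.inr b) := by
    intro q
    rw [Matrix.vecMul, dotProduct, ← (coordEquiv n).sum_comp]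
    rcases q with ⟨⟨i, j, k⟩, σ, τ⟩ | b
    · simp only [probeMLP, Matrix.submatrix_apply, Equiv.symm_apply_apply, Matrix.of_apply]
      simp only [mul_add, Finset.sum_add_distrib, mul_ite, mul_one, mul_zero,
        Finset.sum_ite_eq', Finset.mem_univ, if_true]
      ring
    · simp [probeMLP, mul_comm, y]
  have hout : (probeMLP n fa a c₁ c₂ h).apply f X t (coordEquiv n p) =
      ∑ q : Hidden n, f ((X t ᵥ* (probeMLP n fa a c₁ c₂ h).W₁) (hiddenEquiv n q) + a)
        * (probeMLP n fa a c₁ c₂ h).W₂ (hiddenEquiv n q) (coordEquiv n p)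
        + (probeMLP n fa a c₁ c₂ h).b₂ (coordEquiv n p) := by
    rw [(hiddenEquiv n).sum_comp (fun q => f ((X t ᵥ* (probeMLP n fa a c₁ c₂ h).W₁) q + a)
        * (probeMLP n fa a c₁ c₂ h).W₂ q (coordEquiv n p))]
    rfl
  rw [hout]
  simp only [hin]
  rcases p with (⟨i, j⟩ | ij) | b
  · simp only [probeMLP, Matrix.submatrix_apply, Equiv.symm_apply_apply, Matrix.of_apply,
      Fintype.sum_sum_type, Fintype.sum_prod_type, Fin.sum_univ_two]
    rw [Finset.sum_eq_single (M := ℝ) i (fun b _ hb => by simp [hb.symm]) (by simp),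
      Finset.sum_eq_single (M := ℝ) j (fun b _ hb => by simp [hb.symm]) (by simp),
      Sum.elim_inl, add_zero]
    simp only [reduceCtorEq, if_false, mul_zero, add_zero]
    refine Finset.sum_congr rfl fun k _ => ?_
    simp only [if_true, Fin.val_zero, Fin.val_one, pow_zero, pow_one]
    ring_nf
  · simp [probeMLP]
  · simp [probeMLP, add_comm, sub_eq_add_neg]

/-- In the limit, `probeMLP` multiplies the stored matrices and preserves the positions. -/
theorem tendsto_probeMLP {n m : ℕ} {f : ℝ → ℝ} {a c₁ c₂ : ℝ}
    (hf : (fun u => f (a + u) - (f a + c₁ * u + c₂ * u ^ 2)) =o[𝓝 0] fun u => u ^ 2)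
    (hc₁ : c₁ ≠ 0) (hc₂ : c₂ ≠ 0) {X : ℝ → Matrix (Fin m) (Fin (2 * n ^ 2 + 2)) ℝ}
    {P Q : Fin m → Matrix (Fin n) (Fin n) ℝ} {θ : ℝ}
    (hX : Tendsto X atTop (𝓝 (tokens P Q θ))) :
    Tendsto (fun c => (probeMLP n (f a) a c₁ c₂ c⁻¹).apply f (X c)) atTop
      (𝓝 (tokens (fun t => Q t * P t) 0 θ)) := by
  refine tendsto_pi_nhds.2 fun t => tendsto_pi_nhds.2 fun p => ?_
  obtain ⟨p, rfl⟩ := (coordEquiv n).surjective p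
  have hentry := fun p => tendsto_pi_nhds.1 (tendsto_pi_nhds.1 hX t) (coordEquiv n p)
  have hne : ∀ᶠ c : ℝ in atTop, c⁻¹ ≠ 0 := (eventually_ne_atTop 0).mono fun c => inv_ne_zero
  simp only [probeMLP_apply]
  rcases p with (⟨i, j⟩ | ij) | b
  · simp only [tokens, tokenRow, Matrix.of_apply, Equiv.symm_apply_apply, Sum.elim_inl,
      Matrix.mul_apply]
    refine tendsto_finsetSum _ fun k _ => ?_
    have h1 := hentry (.inl (.inr (i, k)))
    have h2 := hentry (.inl (.inl (k, j)))
    simp only [tokens, tokenRow, Matrix.of_apply, Equiv.symm_apply_apply, Sum.elim_inl,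
      Sum.elim_inr] at h1 h2
    exact tendsto_product_probe hf hc₂ tendsto_inv_atTop_zero hne h1 h2
  · simp [tokens, tokenRow]
  · have h1 := tendsto_linear_probe hf hc₁ tendsto_inv_atTop_zero hne (hentry (.inr b))
    simpa [tokens, tokenRow] using h1

/-! ### The doubling layer -/

/-- The layer that fetches the rows `t` and `t - s` and multiplies their matrices, with scores
multiplied by `c` and hidden units at scale `c⁻¹`. Head `i` looks back `i * s` steps. -/
noncomputable def doublingLayer (n T : ℕ) (fa a c₁ c₂ : ℝ) (s : ℕ) (c : ℝ) :
    TransformerLayer 2 (2 * n ^ 2 + 2) (2 * n ^ 2 + 2) (4 * n ^ 3 + 2) where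
  attn := sharpAttention
    (fun i : Fin 2 => rotationScore n (Real.pi / (2 * T + 1) * ((i * s : ℕ) : ℝ))) (gather n) c
  mlp := probeMLP n fa a c₁ c₂ c⁻¹

theorem tendsto_doublingLayer {n T s : ℕ} (hs : s ≤ T) {f : ℝ → ℝ} {a c₁ c₂ : ℝ}
    (hf : (fun u => f (a + u) - (f a + c₁ * u + c₂ * u ^ 2)) =o[𝓝 0] fun u => u ^ 2)
    (hc₁ : c₁ ≠ 0) (hc₂ : c₂ ≠ 0) {X : ℝ → Matrix (Fin (T + 1)) (Fin (2 * n ^ 2 + 2)) ℝ}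
    {P : Fin (T + 1) → Matrix (Fin n) (Fin n) ℝ}
    (hX : Tendsto X atTop (𝓝 (tokens P 0 (Real.pi / (2 * T + 1))))) :
    Tendsto (fun c => (doublingLayer n T (f a) a c₁ c₂ s c).apply f (X c)) atTop
      (𝓝 (tokens (fun t => P (shift s t) * P t) 0 (Real.pi / (2 * T + 1)))) := by
  refine tendsto_probeMLP hf hc₁ hc₂ ?_
  rw [← Function.comp_def P (shift s), ← heads_mul_gather P 0 (Real.pi / (2 * T + 1)) (shift s)
    (fun i : Fin 2 => shift (i * s)) (by ext t; simp [shift]) (by simp)]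
  refine tendsto_sharpAttention (r := fun i : Fin 2 => shift (i * s)) hX fun i t j hj => ?_
  rw [tokens_rotationScore, tokens_rotationScore]
  refine cos_lt_cos_of_ne_shift ?_ hj
  exact (Nat.mul_le_mul_right s (Nat.le_of_lt_succ i.2)).trans (by simpa using hs)

/-! ### Recursive doubling -/

namespace WFA

variable {S : Type*} {n T : ℕ}

/-- The product of the transition matrices of the last `s` symbols read before position `t`, or of
all of them if there are fewer than `s`. -/
def window (A : WFA S n) (x : Fin T → S) (s : ℕ) (t : Fin (T + 1)) : Matrix (Fin n) (Fin n) ℝ :=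
  ((((List.ofFn x).take t).drop (t - s)).map A.trans).prod

theorem window_shift_mul_window (A : WFA S n) (x : Fin T → S) (s : ℕ) (t : Fin (T + 1)) :
    A.window x s (shift s t) * A.window x s t = A.window x (s + s) t := by
  rw [window, window, window, ← List.prod_append, ← List.map_append]
  congr 2
  have h1 : (List.ofFn x).take (shift s t) = ((List.ofFn x).take t).take (t - s) := by
    simp [shift, List.take_take]
  rw [h1]
  simp only [shift]
  rw [← Nat.sub_sub, List.drop_take]
  conv_rhs => rw [← List.take_append_drop (t - s - (t - s - s)) (List.drop _ _), List.drop_drop]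
  rw [Nat.add_sub_cancel' (Nat.sub_le _ _)]

theorem window_one_zero (A : WFA S n) (x : Fin T → S) : A.window x 1 0 = 1 := by
  simp [window]

theorem window_one_succ (A : WFA S n) (x : Fin T → S) (i : Fin T) :
    A.window x 1 i.succ = A.trans (x i) := by
  have : ((List.ofFn x).take (i + 1)).drop i = [x i] := by
    rw [List.take_succ_eq_append_getElem (by simp)]
    simp
  simp [window, this]

theorem states_eq_vecMul_window (A : WFA S n) (x : Fin T → S) {s : ℕ} (t : Fin (T + 1))
    (h : (t : ℕ) ≤ s) :
    A.states x t = A.init ᵥ* A.window x s t := by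
  change A.init ᵥ* _ = _
  rw [window, Nat.sub_eq_zero_of_le h, List.drop_zero]

/-- The transformer with `L` doubling layers, of steps `1, 2, 4, …, 2 ^ (L - 1)`. The
beginning-of-sequence token stores the identity matrix. -/
noncomputable def doublingTransformer (A : WFA S n) (T L : ℕ) (fa a c₁ c₂ c : ℝ) :
    Transformer S T n 2 (2 * n ^ 2 + 2) (2 * n ^ 2 + 2) (4 * n ^ 3 + 2) where
  tok o p := Sum.elim (Sum.elim (fun ij => (o.elim 1 A.trans) ij.1 ij.2) 0) 0
    ((coordEquiv n).symm p)
  pos t := tokenRow 0 0 (Real.pi / (2 * T + 1) * t)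
  layers := (List.range L).map fun l => doublingLayer n T fa a c₁ c₂ (2 ^ l) c
  readout := Matrix.of fun p j => Sum.elim (Sum.elim
    (fun ij => if ij.2 = j then A.init ij.1 else 0) 0) 0 ((coordEquiv n).symm p)

theorem embed_doublingTransformer (A : WFA S n) (L : ℕ) (fa a c₁ c₂ c : ℝ) (x : Fin T → S) :
    (A.doublingTransformer T L fa a c₁ c₂ c).embed x
      = tokens (A.window x 1) 0 (Real.pi / (2 * T + 1)) := by
  ext t p
  obtain ⟨p, rfl⟩ := (coordEquiv n).surjective p
  refine Fin.cases ?_ (fun i => ?_) t <;> rcases p with (⟨i, j⟩ | ij) | b <;>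
    simp [Transformer.embed, doublingTransformer, tokens, tokenRow, window_one_zero,
      window_one_succ]

theorem tendsto_doublingTransformer (A : WFA S n) {f : ℝ → ℝ} {a c₁ c₂ : ℝ}
    (hf : (fun u => f (a + u) - (f a + c₁ * u + c₂ * u ^ 2)) =o[𝓝 0] fun u => u ^ 2)
    (hc₁ : c₁ ≠ 0) (hc₂ : c₂ ≠ 0) (x : Fin T → S) :
    Tendsto (fun c => (A.doublingTransformer T (Nat.clog 2 T) (f a) a c₁ c₂ c).eval f x) atTop
      (𝓝 (A.states x)) := by
  have hlayers : ∀ L ≤ Nat.clog 2 T, Tendsto (fun c =>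
      ((List.range L).map fun l => doublingLayer n T (f a) a c₁ c₂ (2 ^ l) c).foldl
        (fun X l => l.apply f X) (tokens (A.window x 1) 0 (Real.pi / (2 * T + 1)))) atTop
      (𝓝 (tokens (A.window x (2 ^ L)) 0 (Real.pi / (2 * T + 1)))) := by
    intro L
    induction L with
    | zero => intro _; simp
    | succ L ih =>
      intro hL
      have hs : 2 ^ L ≤ T := ((Nat.lt_clog_iff_pow_lt (by simp)).1 hL).le
      have := tendsto_doublingLayer hs hf hc₁ hc₂ (ih (by omega))
      simp only [window_shift_mul_window, ← two_mul, ← pow_succ'] at this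
      simpa only [List.range_succ, List.map_append, List.foldl_append, List.map_cons, List.map_nil,
        List.foldl_cons, List.foldl_nil] using this
  have hread : ∀ t, (tokens (A.window x (2 ^ Nat.clog 2 T)) 0 (Real.pi / (2 * T + 1))
      * (A.doublingTransformer T (Nat.clog 2 T) (f a) a c₁ c₂ 0).readout) t = A.states x t := by
    intro t
    rw [A.states_eq_vecMul_window x t ((Nat.le_of_lt_succ t.2).trans (Nat.le_pow_clog one_lt_two T))]
    ext j
    rw [Matrix.mul_apply, ← (coordEquiv n).sum_comp]
    simp [tokens, tokenRow, doublingTransformer, Matrix.vecMul, dotProduct,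
      Fintype.sum_prod_type, mul_comm]
  have := tendsto_matrix_mul (hlayers _ le_rfl) (tendsto_const_nhds
    (x := (A.doublingTransformer T (Nat.clog 2 T) (f a) a c₁ c₂ 0).readout))
  rw [show _ * _ = A.states x from funext hread] at this
  simpa only [Transformer.eval, embed_doublingTransformer] using! this

end WFA

/-! ### Simulation -/

section

attribute [local instance] Matrix.frobeniusNormedAddCommGroup

theorem WFA.eventually_approxSimulates {S : Type*} [Finite S] {n T : ℕ} (A : WFA S n)
    {F : ℝ → (Fin T → S) → Matrix (Fin (T + 1)) (Fin n) ℝ}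
    (hF : ∀ x, Tendsto (fun c => F c x) atTop (𝓝 (A.states x))) {ε : ℝ} (hε : 0 < ε) :
    ∀ᶠ c in atTop, ApproxSimulates A T ε (F c) :=
  eventually_all.2 fun x => (tendsto_iff_norm_sub_tendsto_zero.1 (hF x)).eventually_lt_const hε

end

theorem theorem2 (act : ℝ → ℝ)
    (hact : ∃ a : ℝ, ContDiffAt ℝ 2 act a ∧ iteratedDeriv 2 act a ≠ 0) (n : ℕ) :
    ∃ h d k N : ℕ,
      h ≤ 2 ∧ d ≤ 2 * n ^ 2 + 2 ∧ k ≤ 2 * n ^ 2 + 2 ∧ N ≤ 2 * n ^ 4 + 3 * n ^ 2 + 1 ∧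
      ∀ T : ℕ, ∃ L : ℕ, L ≤ Nat.clog 2 T ∧
        ∀ (S : Type*) [Finite S] (A : WFA S n) (ε : ℝ), 0 < ε →
          ∃ f : Transformer S T n h d k N,
            f.depth = L ∧ ApproxSimulates A T ε (f.eval act) := by
  rcases Nat.eq_zero_or_pos n with rfl | hn
  -- For `n = 0` the two positional units would exceed the bound on `N`, but every matrix is empty.
  · refine ⟨0, 0, 0, 0, by simp, by simp, by simp, by simp, fun T => ⟨0, by simp, ?_⟩⟩
    intro S _ A ε hε
    let f : Transformer S T 0 0 0 0 0 := ⟨0, 0, [], 0⟩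
    exact ⟨f, rfl, eventually_const.1 (A.eventually_approxSimulates (F := fun _ => f.eval act)
      (fun x => by rw [Subsingleton.elim (A.states x) (f.eval act x)]; exact tendsto_const_nhds) hε)⟩
  · obtain ⟨a, c₁, c₂, hc₁, hc₂, hf⟩ := exists_taylor_two hact
    have hN : 4 * n ^ 3 + 2 ≤ 2 * n ^ 4 + 3 * n ^ 2 + 1 := by
      obtain ⟨k, rfl⟩ : ∃ k, n = k + 1 := ⟨n - 1, by omega⟩
      nlinarith [sq_nonneg k, Nat.zero_le (k ^ 4), Nat.zero_le (k ^ 3)]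
    refine ⟨2, 2 * n ^ 2 + 2, 2 * n ^ 2 + 2, 4 * n ^ 3 + 2, le_rfl, le_rfl, le_rfl, hN,
      fun T => ⟨Nat.clog 2 T, le_rfl, ?_⟩⟩
    intro S _ A ε hε
    obtain ⟨c, hc⟩ := (A.eventually_approxSimulates
      (fun x => A.tendsto_doublingTransformer hf hc₁ hc₂ x) hε).exists
    exact ⟨A.doublingTransformer T (Nat.clog 2 T) (act a) a c₁ c₂ c,
      by simp [Transformer.depth, WFA.doublingTransformer], hc⟩
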